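/- Let $n\ge 1$ and let $A,B$ be $n\times n$ complex Hermitian matrices. For a Hermitian matrix $H$ let $\lambda_1(H)\ge\cdots\ge\lambda_n(H)$ be its eigenvalues counted with multiplicity. There is exactly one family of real numbers $\nu_1(A,B),\dots,\nu_n(A,B)$ (the first-order perturbation coefficients of the pencil $A+tB$ at $t=0$) with the following two properties: for some $r>0$ and every real $t$ with $|t|<r$, the eigenvalues of $A+tB$, counted with multiplicity, can be arranged as $\alpha_1(t),\dots,\alpha_n(t)$ so that $\alpha_j(t)=\lambda_j(A)+t\,\nu_j(A,B)+o(t)$ as $t\to 0$ for every $j$; and $\nu_j(A,B)\ge\nu_l(A,B)$ whenever $j\le l$ and $\lambda_j(A)=\lambda_l(A)$. Let $1\le i_1<\cdots<i_k\le n$ be integers. Then the following three conditions are equivalent. (1) There is a $k$-dimensional subspace $U\subseteq\mathbb C^n$ such that: (a) $U$ is invariant under $A$ and is spanned by $k$ eigenvectors $x_1,\dots,x_k$ of $A$ corresponding to $\lambda_{i_1}(A),\dots,\lambda_{i_k}(A)$, respectively; (b) $U$ is invariant under $B$ and is spanned by $k$ eigenvectors $y_1,\dots,y_k$ of $B$ corresponding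 to $\lambda_1(B),\dots,\lambda_k(B)$, respectively. (2) There are a real number $t_1>0$ and integers $1\le p_1<\cdots<p_k\le n$ with $\lambda_{p_j}(A)=\lambda_{i_j}(A)$ for $j=1,\dots,k$ and $$\sum_{j=1}^k\lambda_{p_j}(A+t_1B)=\sum_{j=1}^k\lambda_{p_j}(A)+t_1\sum_{j=1}^k\lambda_j(B).$$ (3) There are integers $1\le p_1<\cdots<p_k\le n$ with $\lambda_{p_j}(A)=\lambda_{i_j}(A)$ for $j=1,\dots,k$ and $$\sum_{j=1}^k\nu_{p_j}(A,B)=\sum_{j=1}^k\lambda_j(B).$$ -/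

import Mathlib

open Asymptotics Topology

/-- The eigenvalues of an `n × n` hermitian matrix, counted with multiplicity and arranged in
decreasing order. Indices start at `0`: `eig hA j` is the `(j+1)`-st largest eigenvalue. -/
noncomputable def eig {n : ℕ} {A : Matrix (Fin n) (Fin n) ℂ} (hA : A.IsHermitian)
    (j : Fin n) : ℝ :=
  hA.eigenvalues₀ (Fin.cast (Fintype.card_fin n).symm j)

theorem pencil_isHermitian {n : ℕ} {A B : Matrix (Fin n) (Fin n) ℂ}
    (hA : A.IsHermitian) (hB : B.IsHermitian) (t : ℝ) : (A + t • B).IsHermitian := by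
  refine hA.add ?_
  unfold Matrix.IsHermitian
  rw [Matrix.conjTranspose_smul, hB.eq, star_trivial]

/-- `U` is invariant under `M` and is spanned by eigenvectors `x 0, …, x (k-1)` of `M`
corresponding to the eigenvalues `μ 0, …, μ (k-1)`, respectively. (When `U` has dimension `k`,
these vectors form a basis of `U`.) -/
def IsInvariantSpannedByEigenvectors {n k : ℕ} (M : Matrix (Fin n) (Fin n) ℂ)
    (μ : Fin k → ℝ) (U : Submodule ℂ (Fin n → ℂ)) : Prop :=
  (∀ v ∈ U, M.mulVec v ∈ U) ∧
  ∃ x : Fin k → (Fin n → ℂ),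
    (∀ j, Module.End.HasEigenvector (Matrix.toLin' M) (μ j : ℂ) (x j)) ∧
    Submodule.span ℂ (Set.range x) = U

/-- `ν` is the family of first-order perturbation coefficients of the hermitian pencil `A + tB` at
`t = 0`: for small `t` the eigenvalues of `A + tB` can be arranged as `α 0 t, …, α (n-1) t` with
`α j t = λ_j(A) + t (ν j + o(1))` as `t → 0`, where, among the indices `j` belonging to one and the
same eigenvalue of `A`, the coefficients `ν j` are arranged in decreasing order. -/
def IsPerturbationCoefficients {n : ℕ} {A B : Matrix (Fin n) (Fin n) ℂ}
    (hA : A.IsHermitian) (hB : B.IsHermitian) (ν : Fin n → ℝ) : Prop :=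
  (∃ r > 0, ∃ α : Fin n → ℝ → ℝ,
    (∀ t : ℝ, |t| < r → ∃ σ : Equiv.Perm (Fin n),
      ∀ j, α j t = eig (pencil_isHermitian hA hB t) (σ j)) ∧
    ∀ j, (fun t : ℝ => α j t - (eig hA j + t * ν j)) =o[𝓝 0] (fun t : ℝ => t)) ∧
  ∀ j l : Fin n, j ≤ l → eig hA j = eig hA l → ν l ≤ ν j

/-! The engine is Lidskii's inequality `sum_eig_add_smul_le`: along the pencil, the sum of the
eigenvalues at `k` fixed positions grows over a step `s ≥ 0` by at most `s` times the sum of the `k`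
largest eigenvalues of `B`.

(2) ⇒ (3): equality at `t` leaves no slack on `[0, s]` or `[s, t]`, so the sum is affine near `0+`,
and its slope there is the sum of the coefficients.

(3) ⇒ (1): in an orthonormal eigenbasis of `A` that also diagonalizes the compression of `B` to each
eigenspace (`exists_adapted_eigenbasis`), the coefficients are the diagonal entries of `B`.
Condition (3) then says that the compression of `B` to the span of `k` basis vectors has the largest
possible trace, and the equality case of Ky Fan's principle (`mul_eq_of_trace_compression_eq`) makes
this span invariant under `B`.

(1) ⇒ (2): on `U` the pencil restricts to a `k × k` pencil whose eigenvalues are eigenvalues of `A +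
tB` and whose trace is affine in `t`. For small `t` the spectral gaps of `A` decide which eigenvalue
of `A` each of them comes from.

Existence of the coefficients follows by conjugating the pencil with `exp (tK)`, where `K` cancels
the part of `B` between different eigenspaces to first order. Uniqueness holds because the ordering
condition makes them one-sided derivatives of the ordered eigenvalues. -/

section

open Matrix

/-! ### Ordered eigenvalues and diagonalization -/

section SpectralBasics

theorem eig_antitone {n : ℕ} {M : Matrix (Fin n) (Fin n) ℂ} (hM : M.IsHermitian) :
    Antitone (eig hM) := fun _ _ h => hM.eigenvalues₀_antitone (by simpa using h)

/-- Spectral theorem, with the eigenvalues in decreasing order. -/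
theorem exists_unitary_mul_eq_mul_diagonal_eig {n : ℕ} {M : Matrix (Fin n) (Fin n) ℂ}
    (hM : M.IsHermitian) : ∃ Q : Matrix (Fin n) (Fin n) ℂ, Qᴴ * Q = 1 ∧ Q * Qᴴ = 1 ∧
      M * Q = Q * diagonal fun j => (eig hM j : ℂ) := by
  set e : Fin n ≃ Fin n :=
    (finCongr (Fintype.card_fin n).symm).trans (Fintype.equivOfCardEq (Fintype.card_fin _))
  have he : ∀ j, hM.eigenvalues (e j) = eig hM j := fun j => by
    simp [Matrix.IsHermitian.eigenvalues, e, eig]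
  set Q : Matrix (Fin n) (Fin n) ℂ := hM.eigenvectorUnitary.1.submatrix id e
  have h1 : Qᴴ * Q = 1 := by
    have hu : (hM.eigenvectorUnitary.1)ᴴ * hM.eigenvectorUnitary.1 = 1 :=
      Unitary.coe_star_mul_self hM.eigenvectorUnitary
    rw [conjTranspose_submatrix]
    exact (submatrix_mul _ _ e id e Function.bijective_id).symm.trans
      (by rw [hu, submatrix_one_equiv])
  refine ⟨Q, h1, mul_eq_one_comm.mp h1, ?_⟩
  ext a j
  have := congrFun (hM.mulVec_eigenvectorBasis (e j)) a
  rw [he] at this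
  rw [mul_diagonal]
  simpa [Q, mul_apply, mulVec, dotProduct, mul_comm] using this

/-- Eigenvalues attached to independent eigenvectors are picked injectively from `eig`. -/
theorem exists_injective_eig_comp {n k : ℕ} {M : Matrix (Fin n) (Fin n) ℂ} (hM : M.IsHermitian)
    {V : Matrix (Fin n) (Fin k) ℂ} {L : Matrix (Fin k) (Fin n) ℂ} (hV : (L * V).det ≠ 0)
    {μ : Fin k → ℝ} (h : M * V = V * diagonal fun j => (μ j : ℂ)) :
    ∃ q : Fin k → Fin n, Function.Injective q ∧ ∀ j, eig hM (q j) = μ j := by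
  obtain ⟨Q, hQ, hQ', hMQ⟩ := exists_unitary_mul_eq_mul_diagonal_eig hM
  set T := Qᴴ * V with hT
  have hDT : (diagonal fun j => (eig hM j : ℂ)) * T = T * diagonal fun j => (μ j : ℂ) := by
    have h1 : Qᴴ * (M * Q) * T = Qᴴ * (M * V) := by
      rw [hT, Matrix.mul_assoc, Matrix.mul_assoc M, ← Matrix.mul_assoc Q, hQ', Matrix.one_mul]
    rwa [h, hMQ, ← Matrix.mul_assoc Qᴴ Q, hQ, Matrix.one_mul, ← Matrix.mul_assoc Qᴴ V, ← hT] at h1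
  have hLV : L * V = (L * Q) * T := by
    rw [hT, Matrix.mul_assoc, ← Matrix.mul_assoc Q, hQ', Matrix.one_mul]
  set S := L * Q
  by_contra hcon
  push Not at hcon
  apply hV
  rw [hLV, ← det_transpose]
  -- Expanding the determinant multilinearly gives a sum over maps `q : Fin k → Fin n`. A
  -- non-injective `q` repeats a row; an injective one has, by `hcon`, some `j` where the
  -- eigenvalues differ, and there the entry of `T` vanishes.
  have hrow : (S * T)ᵀ = fun j => ∑ l, T l j • Sᵀ l := by
    ext j i
    simp [mul_apply, mul_comm, Finset.sum_apply]
  have : (S * T)ᵀ.det = detRowAlternating (R := ℂ) (n := Fin k) (S * T)ᵀ := rfl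
  rw [this, hrow]
  have h2 := (detRowAlternating (R := ℂ) (n := Fin k)).toMultilinearMap.map_sum
    (fun (j : Fin k) (l : Fin n) => T l j • Sᵀ l)
  refine h2.trans (Finset.sum_eq_zero fun q _ => ?_)
  rw [MultilinearMap.map_smul_univ]
  by_cases hq : Function.Injective q
  · obtain ⟨j, hj⟩ := hcon q hq
    have hz : T (q j) j = 0 := by
      have := congrFun (congrFun hDT (q j)) j
      rw [diagonal_mul, mul_diagonal, mul_comm, ← sub_eq_zero, ← mul_sub] at this
      rcases mul_eq_zero.mp this with h | h
      · exact h
      · exact absurd (by exact_mod_cast sub_eq_zero.mp h) hj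
    have hp : ∏ i, T (q i) i = 0 := Finset.prod_eq_zero (Finset.mem_univ j) hz
    exact (congrArg (· • _) hp).trans (zero_smul _ _)
  · rw [Function.not_injective_iff] at hq
    obtain ⟨a, b, hab, hne⟩ := hq
    have : (detRowAlternating (R := ℂ) (n := Fin k)) (fun j => Sᵀ (q j)) = 0 :=
      AlternatingMap.map_eq_zero_of_eq _ _ (by simp [hab]) hne
    exact (congrArg _ this).trans (smul_zero _)

/-- Sort `q`. If `f ∘ q = g`, then `g` reordered by the sorting permutation is antitone again, and
an antitone rearrangement of an antitone family is that family. -/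
theorem exists_strictMono_comp_of_injective {n k : ℕ} {f : Fin n → ℝ} (hf : Antitone f)
    {g : Fin k → ℝ} (hg : Antitone g) {q : Fin k → Fin n} (hq : Function.Injective q) :
    ∃ τ : Equiv.Perm (Fin k), StrictMono (q ∘ τ) ∧ ((∀ j, f (q j) = g j) → g ∘ τ = g) := by
  refine ⟨Tuple.sort q, (Tuple.monotone_sort q).strictMono_of_injective
    (hq.comp (Equiv.injective _)), fun h => ?_⟩
  have h1 : Antitone (g ∘ Tuple.sort q) := by
    have : g ∘ Tuple.sort q = f ∘ (q ∘ Tuple.sort q) := by ext j; simp [h]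
    rw [this]
    exact hf.comp_monotone (Tuple.monotone_sort q)
  exact Tuple.unique_antitone (τ := Equiv.refl _) h1 hg

theorem exists_strictMono_eig_comp {n k : ℕ} {M : Matrix (Fin n) (Fin n) ℂ} (hM : M.IsHermitian)
    {V : Matrix (Fin n) (Fin k) ℂ} {L : Matrix (Fin k) (Fin n) ℂ} (hV : (L * V).det ≠ 0)
    {μ : Fin k → ℝ} (hμ : Antitone μ) (h : M * V = V * diagonal fun j => (μ j : ℂ)) :
    ∃ q : Fin k → Fin n, StrictMono q ∧ ∀ j, eig hM (q j) = μ j := by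
  obtain ⟨q, hq, hqμ⟩ := exists_injective_eig_comp hM hV h
  obtain ⟨τ, hτ, hg⟩ := exists_strictMono_comp_of_injective (eig_antitone hM) hμ hq
  exact ⟨q ∘ τ, hτ, fun j => (hqμ _).trans (congrFun (hg hqμ) j)⟩

theorem Fin.strictMono_eq_id {n : ℕ} {f : Fin n → Fin n} (hf : StrictMono f) (j : Fin n) :
    f j = j := le_antisymm hf.apply_le hf.le_apply

theorem eig_eq_of_mul_eq_mul_diagonal {n : ℕ} {M V L : Matrix (Fin n) (Fin n) ℂ}
    (hM : M.IsHermitian) (hV : (L * V).det ≠ 0)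
    {μ : Fin n → ℝ} (hμ : Antitone μ) (h : M * V = V * diagonal fun j => (μ j : ℂ)) (j : Fin n) :
    eig hM j = μ j := by
  obtain ⟨q, hq, hqμ⟩ := exists_strictMono_eig_comp hM hV hμ h
  rw [← hqμ, Fin.strictMono_eq_id hq]

theorem isHermitian_diagonal_ofReal {n : ℕ} (d : Fin n → ℝ) :
    (diagonal fun j => (d j : ℂ)).IsHermitian := by
  apply isHermitian_diagonal_of_self_adjoint
  ext j
  simp

theorem eig_diagonal {n : ℕ} {d : Fin n → ℝ} (hd : Antitone d) (j : Fin n) :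
    eig (isHermitian_diagonal_ofReal d) j = d j :=
  eig_eq_of_mul_eq_mul_diagonal (V := 1) (L := 1) _ (by simp) hd (by simp) j

theorem exists_perm_eig_diagonal {n : ℕ} (d : Fin n → ℝ) :
    ∃ σ : Equiv.Perm (Fin n), ∀ j, eig (isHermitian_diagonal_ofReal d) (σ j) = d j := by
  obtain ⟨q, hq, h⟩ := exists_injective_eig_comp (V := 1) (L := 1)
    (isHermitian_diagonal_ofReal d) (by simp) (μ := d) (by simp)
  exact ⟨Equiv.ofBijective q (Finite.injective_iff_bijective.mp hq), h⟩

theorem eig_conj_unitary {n : ℕ} {M N U : Matrix (Fin n) (Fin n) ℂ} (hM : M.IsHermitian)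
    (hN : N.IsHermitian) (hU : U * Uᴴ = 1) (h : N = Uᴴ * M * U) (j : Fin n) :
    eig hN j = eig hM j := by
  obtain ⟨Q, hQ, hQ', hMQ⟩ := exists_unitary_mul_eq_mul_diagonal_eig hM
  refine eig_eq_of_mul_eq_mul_diagonal (V := Uᴴ * Q) (L := Qᴴ * U) hN ?_ (eig_antitone hM) ?_ j
  · rw [Matrix.mul_assoc, ← Matrix.mul_assoc U, hU, Matrix.one_mul, hQ]; simp
  · rw [h, Matrix.mul_assoc, ← Matrix.mul_assoc U, hU, Matrix.one_mul, Matrix.mul_assoc, hMQ,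
      Matrix.mul_assoc]

theorem sum_eig_eq_trace {n : ℕ} {M : Matrix (Fin n) (Fin n) ℂ} (hM : M.IsHermitian) :
    ((∑ j, eig hM j : ℝ) : ℂ) = M.trace := by
  obtain ⟨Q, hQ, hQ', hMQ⟩ := exists_unitary_mul_eq_mul_diagonal_eig hM
  have : M.trace = (M * Q * Qᴴ).trace := by rw [Matrix.mul_assoc, hQ', Matrix.mul_one]
  rw [this, hMQ, trace_mul_comm, ← Matrix.mul_assoc, hQ, Matrix.one_mul, trace_diagonal]
  simp

end SpectralBasics

/-! ### Quadratic forms and Lipschitz bounds for eigenvalues -/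

section Comparison

/-- The real part of the sesquilinear form of a matrix at a vector. -/
noncomputable def quadForm {n : ℕ} (M : Matrix (Fin n) (Fin n) ℂ) (v : Fin n → ℂ) : ℝ :=
  (star v ⬝ᵥ M *ᵥ v).re

theorem quadForm_add {n : ℕ} (M N : Matrix (Fin n) (Fin n) ℂ) (v : Fin n → ℂ) :
    quadForm (M + N) v = quadForm M v + quadForm N v := by
  simp [quadForm, add_mulVec]

theorem quadForm_sub {n : ℕ} (M N : Matrix (Fin n) (Fin n) ℂ) (v : Fin n → ℂ) :
    quadForm (M - N) v = quadForm M v - quadForm N v := by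
  simp [quadForm, sub_mulVec]

theorem quadForm_smul {n : ℕ} (c : ℝ) (M : Matrix (Fin n) (Fin n) ℂ) (v : Fin n → ℂ) :
    quadForm (c • M) v = c * quadForm M v := by
  simp [quadForm, smul_mulVec]

theorem star_dotProduct_self {n : ℕ} (v : Fin n → ℂ) :
    star v ⬝ᵥ v = ((∑ i, ‖v i‖ ^ 2 : ℝ) : ℂ) := by
  simp [dotProduct, ← Complex.conj_mul']

theorem quadForm_one {n : ℕ} (v : Fin n → ℂ) : quadForm 1 v = ∑ i, ‖v i‖ ^ 2 := by
  rw [quadForm, one_mulVec, star_dotProduct_self, Complex.ofReal_re]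

theorem quadForm_conjTranspose_mul_self_nonneg {n : ℕ} (R : Matrix (Fin n) (Fin n) ℂ)
    (v : Fin n → ℂ) : 0 ≤ quadForm (Rᴴ * R) v := by
  rw [quadForm, ← mulVec_mulVec, dotProduct_mulVec, ← star_mulVec, star_dotProduct_self,
    Complex.ofReal_re]
  positivity

theorem quadForm_conj {n : ℕ} (M Q : Matrix (Fin n) (Fin n) ℂ) (v : Fin n → ℂ) :
    quadForm M (Q *ᵥ v) = quadForm (Qᴴ * M * Q) v := by
  simp [quadForm, star_mulVec, dotProduct_mulVec, Matrix.vecMul_vecMul, Matrix.mul_assoc]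

theorem quadForm_diagonal {n : ℕ} (d : Fin n → ℝ) (v : Fin n → ℂ) :
    quadForm (diagonal fun j => (d j : ℂ)) v = ∑ j, d j * ‖v j‖ ^ 2 := by
  rw [quadForm, dotProduct, Complex.re_sum]
  refine Finset.sum_congr rfl fun j _ => ?_
  have : star v j * ((diagonal fun j => (d j : ℂ)) *ᵥ v) j = ((d j * ‖v j‖ ^ 2 : ℝ) : ℂ) := by
    rw [mulVec_diagonal]
    push_cast
    rw [← Complex.conj_mul']
    simp
    ring
  rw [this, Complex.ofReal_re]

/-- Comparison of ordered eigenvalues from a comparison of quadratic forms. -/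
theorem eig_le_eig_add {n : ℕ} {X Y : Matrix (Fin n) (Fin n) ℂ} (hX : X.IsHermitian)
    (hY : Y.IsHermitian) {c : ℝ}
    (h : ∀ v, quadForm X v ≤ quadForm Y v + c * ∑ i, ‖v i‖ ^ 2) (j : Fin n) :
    eig hX j ≤ eig hY j + c := by
  obtain ⟨Q, hQ, hQ', hXQ⟩ := exists_unitary_mul_eq_mul_diagonal_eig hX
  obtain ⟨P, hP, hP', hYP⟩ := exists_unitary_mul_eq_mul_diagonal_eig hY
  set T := Pᴴ * Q with hT
  -- The dimension count of Courant–Fischer as one singular matrix: a kernel vector `a` has no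
  -- `X`-coordinates beyond `j`, and its image `b` has no `Y`-coordinates before `j`. Row `j` is
  -- zero.
  let R : Matrix (Fin n) (Fin n) ℂ := fun l =>
    if j < l then Pi.single l 1 else if l < j then T l else 0
  have hR : R.det = 0 := det_eq_zero_of_row_eq_zero j fun l => by simp [R]
  obtain ⟨a, ha, hRa⟩ := exists_mulVec_eq_zero_iff.mpr hR
  have ha1 : ∀ l, j < l → a l = 0 := fun l hl => by
    have := congrFun hRa l
    simpa [mulVec, R, hl] using this
  set b := T *ᵥ a with hb
  have hb1 : ∀ l, l < j → b l = 0 := fun l hl => by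
    have := congrFun hRa l
    simpa [mulVec, R, hl, hl.le, not_lt.mpr hl.le, hb] using this
  have hQb : Q *ᵥ a = P *ᵥ b := by
    rw [hb, hT, mulVec_mulVec, ← Matrix.mul_assoc, hP', Matrix.one_mul]
  have nQ : ∑ i, ‖(Q *ᵥ a) i‖ ^ 2 = ∑ i, ‖a i‖ ^ 2 := by
    rw [← quadForm_one, quadForm_conj, Matrix.mul_one, hQ, quadForm_one]
  have nP : ∑ i, ‖(Q *ᵥ a) i‖ ^ 2 = ∑ i, ‖b i‖ ^ 2 := by
    rw [hQb, ← quadForm_one, quadForm_conj, Matrix.mul_one, hP, quadForm_one]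
  have hpos : 0 < ∑ i, ‖a i‖ ^ 2 := by
    obtain ⟨i, hi⟩ := Function.ne_iff.mp ha
    have : 0 < ‖a i‖ := norm_pos_iff.mpr hi
    exact Finset.sum_pos' (fun _ _ => by positivity) ⟨i, Finset.mem_univ _, by positivity⟩
  have hv := h (Q *ᵥ a)
  rw [nQ, quadForm_conj, Matrix.mul_assoc, hXQ, ← Matrix.mul_assoc, hQ, Matrix.one_mul,
    quadForm_diagonal, hQb, quadForm_conj, Matrix.mul_assoc, hYP, ← Matrix.mul_assoc, hP,
    Matrix.one_mul, quadForm_diagonal] at hv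
  have lo : eig hX j * ∑ i, ‖a i‖ ^ 2 ≤ ∑ i, eig hX i * ‖a i‖ ^ 2 := by
    rw [Finset.mul_sum]
    refine Finset.sum_le_sum fun l _ => ?_
    rcases lt_or_ge j l with hl | hl
    · simp [ha1 l hl]
    · exact mul_le_mul_of_nonneg_right (eig_antitone hX hl) (by positivity)
  have hi : ∑ i, eig hY i * ‖b i‖ ^ 2 ≤ eig hY j * ∑ i, ‖a i‖ ^ 2 := by
    rw [← nQ, nP, Finset.mul_sum]
    refine Finset.sum_le_sum fun l _ => ?_
    rcases lt_or_ge l j with hl | hl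
    · simp [hb1 l hl]
    · exact mul_le_mul_of_nonneg_right (eig_antitone hY hl) (by positivity)
  nlinarith

theorem abs_quadForm_le {n : ℕ} (M : Matrix (Fin n) (Fin n) ℂ) (v : Fin n → ℂ) :
    |quadForm M v| ≤ (∑ a, ∑ b, ‖M a b‖) * ∑ i, ‖v i‖ ^ 2 := by
  have hle : ∀ a b : Fin n, ‖v a‖ * ‖v b‖ ≤ ∑ i, ‖v i‖ ^ 2 := fun a b => by
    have h1 : ∀ a, ‖v a‖ ^ 2 ≤ ∑ i, ‖v i‖ ^ 2 := fun a =>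
      Finset.single_le_sum (f := fun i => ‖v i‖ ^ 2) (fun i _ => by positivity) (Finset.mem_univ a)
    nlinarith [h1 a, h1 b, sq_nonneg (‖v a‖ - ‖v b‖)]
  calc |quadForm M v| ≤ ‖star v ⬝ᵥ M *ᵥ v‖ := Complex.abs_re_le_norm _
    _ ≤ ∑ a, ‖star v a * (M *ᵥ v) a‖ := norm_sum_le _ _
    _ ≤ ∑ a, ∑ b, ‖M a b‖ * ∑ i, ‖v i‖ ^ 2 := by
      refine Finset.sum_le_sum fun a _ => ?_
      rw [mulVec, dotProduct, Finset.mul_sum]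
      refine (norm_sum_le _ _).trans (Finset.sum_le_sum fun b _ => ?_)
      rw [norm_mul, norm_mul]
      have : ‖star v a‖ = ‖v a‖ := by simp
      rw [this]
      nlinarith [mul_le_mul_of_nonneg_left (hle a b) (norm_nonneg (M a b))]
    _ = _ := by simp_rw [Finset.sum_mul]

/-- Lipschitz continuity of ordered eigenvalues. -/
theorem abs_eig_sub_eig_le {n : ℕ} {X Y : Matrix (Fin n) (Fin n) ℂ} (hX : X.IsHermitian)
    (hY : Y.IsHermitian) (j : Fin n) :
    |eig hX j - eig hY j| ≤ ∑ a, ∑ b, ‖X a b - Y a b‖ := by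
  have key := fun v => abs_le.mp (abs_quadForm_le (X - Y) v)
  simp only [quadForm_sub, Matrix.sub_apply] at key
  have h1 := eig_le_eig_add hX hY (c := ∑ a, ∑ b, ‖X a b - Y a b‖)
    (fun v => by linarith [(key v).2]) j
  have h2 := eig_le_eig_add hY hX (c := ∑ a, ∑ b, ‖X a b - Y a b‖)
    (fun v => by linarith [(key v).1]) j
  exact abs_le.mpr ⟨by linarith, by linarith⟩

end Comparison

/-! ### Lidskii's inequality and the equality case of Ky Fan's principle -/

/-- The `k`-th largest eigenvalue, at index `k - 1`, serves as threshold; for `k = 0` any common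
upper bound does. -/
theorem exists_eig_threshold {n : ℕ} {M : Matrix (Fin n) (Fin n) ℂ} (hM : M.IsHermitian)
    {k : ℕ} (hk : k ≤ n) :
    ∃ c : ℝ, (∀ l : Fin n, (l : ℕ) < k → c ≤ eig hM l) ∧
      ∀ l : Fin n, k ≤ (l : ℕ) → eig hM l ≤ c := by
  rcases Nat.eq_zero_or_pos k with rfl | hk0
  · exact ⟨∑ l, |eig hM l|, fun l hl => absurd hl (Nat.not_lt_zero _), fun l _ =>
      (le_abs_self _).trans (Finset.single_le_sum (f := fun l => |eig hM l|)
        (fun _ _ => abs_nonneg _) (Finset.mem_univ l))⟩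
  · refine ⟨eig hM ⟨k - 1, by omega⟩, fun l hl => eig_antitone hM ?_,
      fun l hl => eig_antitone hM ?_⟩
    · rw [Fin.le_def]; simp only; omega
    · rw [Fin.le_def]; simp only; omega

theorem sum_castLE {n k : ℕ} (hk : k ≤ n) (f : Fin n → ℝ) :
    ∑ l : Fin k, f (Fin.castLE hk l) = ∑ l : Fin n, if (l : ℕ) < k then f l else 0 := by
  rw [← Finset.sum_filter]
  refine Finset.sum_bij (fun l _ => Fin.castLE hk l) (by simp) (by simp) (fun l hl => ?_)
    (by simp)
  exact ⟨⟨l, (Finset.mem_filter.mp hl).2⟩, by simp, rfl⟩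

/-- Splitting of a hermitian matrix, shifted by a threshold below its `k` largest eigenvalues,
into positive and negative parts. -/
theorem exists_threshold_decomposition {n : ℕ} {M : Matrix (Fin n) (Fin n) ℂ}
    (hM : M.IsHermitian) {k : ℕ} (hk : k ≤ n) :
    ∃ (c : ℝ) (R S : Matrix (Fin n) (Fin n) ℂ), M = c • (1 : Matrix (Fin n) (Fin n) ℂ) +
      (Rᴴ * R - Sᴴ * S) ∧
      (Rᴴ * R).trace = ((∑ l : Fin k, (eig hM (Fin.castLE hk l)) - k * c : ℝ) : ℂ) := by
  obtain ⟨Q, hQ, hQ', hMQ⟩ := exists_unitary_mul_eq_mul_diagonal_eig hM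
  obtain ⟨c, hc1, hc2⟩ := exists_eig_threshold hM hk
  -- `√` is zero on negative reals, so `f ^ 2` and `g ^ 2` are the positive and negative parts of
  -- `eig hM l - c`.
  set f : Fin n → ℝ := fun l => √(eig hM l - c)
  set g : Fin n → ℝ := fun l => √(c - eig hM l)
  have hsq : ∀ f : Fin n → ℝ, ((diagonal fun l => (f l : ℂ)) * Qᴴ)ᴴ *
      ((diagonal fun l => (f l : ℂ)) * Qᴴ) = Q * (diagonal fun l => ((f l ^ 2 : ℝ) : ℂ)) * Qᴴ := by
    intro f
    rw [conjTranspose_mul, conjTranspose_conjTranspose, (isHermitian_diagonal_ofReal f).eq,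
      Matrix.mul_assoc, ← Matrix.mul_assoc (diagonal _), diagonal_mul_diagonal, Matrix.mul_assoc]
    simp [sq]
  refine ⟨c, (diagonal fun l => (f l : ℂ)) * Qᴴ, (diagonal fun l => (g l : ℂ)) * Qᴴ, ?_, ?_⟩
  · have hfg : ∀ l, eig hM l = c + (f l ^ 2 - g l ^ 2) := fun l => by
      rcases lt_or_ge (l : ℕ) k with hl | hl
      · have := hc1 l hl
        simp only [f, g]
        rw [Real.sq_sqrt (by linarith), Real.sqrt_eq_zero_of_nonpos (by linarith)]
        ring
      · have := hc2 l hl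
        simp only [f, g]
        rw [Real.sq_sqrt (by linarith : 0 ≤ c - eig hM l), Real.sqrt_eq_zero_of_nonpos (by linarith)]
        ring
    have hM' : M = Q * (diagonal fun l => (eig hM l : ℂ)) * Qᴴ := by
      rw [← hMQ, Matrix.mul_assoc, hQ', Matrix.mul_one]
    have hd : (diagonal fun l => (eig hM l : ℂ)) = c • (1 : Matrix (Fin n) (Fin n) ℂ) +
        ((diagonal fun l => ((f l ^ 2 : ℝ) : ℂ)) - diagonal fun l => ((g l ^ 2 : ℝ) : ℂ)) := by
      ext a b
      by_cases hab : a = b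
      · subst hab
        have := hfg a
        simp only [diagonal_apply_eq, Matrix.add_apply, Matrix.smul_apply, Matrix.sub_apply, one_apply_eq]
        rw [this]
        simp
      · simp [hab]
    rw [hsq, hsq]
    conv_lhs => rw [hM', hd]
    rw [Matrix.mul_add, Matrix.mul_sub, Matrix.add_mul, Matrix.sub_mul, Matrix.mul_smul,
      Matrix.smul_mul, Matrix.mul_one, hQ']
  · rw [hsq, trace_mul_comm, ← Matrix.mul_assoc, hQ, Matrix.one_mul, trace_diagonal,
      ← Complex.ofReal_sum]
    congr 1
    have : ∑ l : Fin k, eig hM (Fin.castLE hk l) - k * c =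
        ∑ l : Fin k, (eig hM (Fin.castLE hk l) - c) := by
      rw [Finset.sum_sub_distrib]; simp
    rw [this, sum_castLE hk (fun l => eig hM l - c)]
    refine Finset.sum_congr rfl fun l _ => ?_
    split_ifs with hl
    · exact Real.sq_sqrt (sub_nonneg.mpr (hc1 l hl))
    · simp only [f]
      rw [Real.sqrt_eq_zero_of_nonpos (sub_nonpos.mpr (hc2 l (not_lt.mp hl)))]
      simp

/-- Lidskii's inequality. -/
theorem sum_eig_add_smul_le {n k : ℕ} {X Y B : Matrix (Fin n) (Fin n) ℂ} (hX : X.IsHermitian)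
    (hY : Y.IsHermitian) (hB : B.IsHermitian) (hk : k ≤ n) {s : ℝ} (hs : 0 ≤ s)
    (hXY : Y = X + s • B) {p : Fin k → Fin n} (hp : StrictMono p) :
    ∑ j, eig hY (p j) ≤ ∑ j, eig hX (p j) + s * ∑ j : Fin k, eig hB (Fin.castLE hk j) := by
  obtain ⟨c, R, S, hBd, htr⟩ := exists_threshold_decomposition hB hk
  -- The majorant `Z = X + s • RᴴR` satisfies `X ≤ Z` and `Y ≤ Z + s * c`. The increments from `X`
  -- to `Z` are nonnegative, so any `k` of them sum to at most the trace of `s • RᴴR`.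
  have hZ : (X + s • (Rᴴ * R)).IsHermitian :=
    pencil_isHermitian hX (isHermitian_conjTranspose_mul_self R) s
  have hXZ : ∀ j, eig hX j ≤ eig hZ j := fun j => by
    simpa using eig_le_eig_add hX hZ (c := 0) (fun v => by
      rw [quadForm_add, quadForm_smul]
      linarith [mul_nonneg hs (quadForm_conjTranspose_mul_self_nonneg R v)]) j
  have hYZ : ∀ j, eig hY j ≤ eig hZ j + s * c := eig_le_eig_add hY hZ (fun v => by
      rw [hXY, hBd]
      simp only [quadForm_add, quadForm_smul, quadForm_sub, quadForm_one]
      linarith [mul_nonneg hs (quadForm_conjTranspose_mul_self_nonneg S v)])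
  have htrace : ∑ j, (eig hZ j - eig hX j) =
      s * (∑ j : Fin k, eig hB (Fin.castLE hk j) - k * c) := by
    have : ((∑ j, (eig hZ j - eig hX j) : ℝ) : ℂ) =
        ((s * (∑ j : Fin k, eig hB (Fin.castLE hk j) - k * c) : ℝ) : ℂ) := by
      rw [Finset.sum_sub_distrib, Complex.ofReal_sub, sum_eig_eq_trace, sum_eig_eq_trace,
        trace_add, trace_smul, htr]
      simp
    exact_mod_cast this
  have hpart : ∑ j, (eig hZ (p j) - eig hX (p j)) ≤ ∑ j, (eig hZ j - eig hX j) := by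
    refine (Finset.sum_map Finset.univ ⟨p, hp.injective⟩
      (fun j => eig hZ j - eig hX j)).symm.trans_le ?_
    exact Finset.sum_le_sum_of_subset_of_nonneg (Finset.subset_univ _)
      fun j _ _ => sub_nonneg.mpr (hXZ j)
  have h1 : ∑ j, eig hY (p j) ≤ ∑ j, (eig hZ (p j) + s * c) :=
    Finset.sum_le_sum fun j _ => hYZ _
  rw [Finset.sum_add_distrib] at h1
  simp only [Finset.sum_const, Finset.card_univ, Fintype.card_fin, nsmul_eq_mul] at h1
  rw [Finset.sum_sub_distrib] at hpart
  linarith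

open scoped ComplexOrder in
/-- Equality case of Ky Fan's maximum principle. -/
theorem mul_eq_of_trace_compression_eq {n k : ℕ} {B : Matrix (Fin n) (Fin n) ℂ}
    (hB : B.IsHermitian) (hk : k ≤ n) {W : Matrix (Fin n) (Fin k) ℂ} (hW : Wᴴ * W = 1)
    (h : (Wᴴ * B * W).trace = ((∑ j : Fin k, eig hB (Fin.castLE hk j) : ℝ) : ℂ)) :
    B * W = W * (Wᴴ * B * W) := by
  obtain ⟨c, R, S, hBd, htr⟩ := exists_threshold_decomposition hB hk
  have hcomp : Wᴴ * B * W = c • (1 : Matrix (Fin k) (Fin k) ℂ) +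
      ((R * W)ᴴ * (R * W) - (S * W)ᴴ * (S * W)) := by
    conv_lhs => rw [hBd]
    simp only [Matrix.mul_add, Matrix.add_mul, Matrix.mul_sub, Matrix.sub_mul, Matrix.mul_smul,
      Matrix.smul_mul, Matrix.mul_one, hW, conjTranspose_mul, Matrix.mul_assoc]
  -- `N` is `R` restricted to the orthogonal complement of the range of `W`. Maximality of the trace
  -- makes the squared Frobenius norms of `N` and `S * W` add up to zero, so both vanish.
  set N := R - R * W * Wᴴ with hN
  have hNN : (Nᴴ * N).trace = (Rᴴ * R).trace - ((R * W)ᴴ * (R * W)).trace := by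
    have e1 : ((R * W * Wᴴ)ᴴ * (R * W * Wᴴ)).trace = ((R * W)ᴴ * (R * W)).trace := by
      rw [conjTranspose_mul (R * W), conjTranspose_conjTranspose, trace_mul_comm,
        ← Matrix.mul_assoc, Matrix.mul_assoc (R * W), hW, Matrix.mul_one, trace_mul_comm]
    have e2 : (Rᴴ * (R * W * Wᴴ)).trace = ((R * W)ᴴ * (R * W)).trace := by
      rw [← Matrix.mul_assoc, trace_mul_comm, conjTranspose_mul, Matrix.mul_assoc]
    have e3 : ((R * W * Wᴴ)ᴴ * R).trace = ((R * W)ᴴ * (R * W)).trace := by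
      rw [conjTranspose_mul (R * W), conjTranspose_conjTranspose, Matrix.mul_assoc, trace_mul_comm,
        Matrix.mul_assoc]
    rw [hN, conjTranspose_sub, Matrix.sub_mul, Matrix.mul_sub, Matrix.mul_sub, trace_sub,
      trace_sub, trace_sub, e1, e2, e3]
    ring
  have hsum : (Nᴴ * N).trace + ((S * W)ᴴ * (S * W)).trace = 0 := by
    rw [hcomp, trace_add, trace_sub, trace_smul, trace_one] at h
    rw [hNN, htr]
    simp only [Fintype.card_fin, Complex.real_smul] at h
    push_cast at h ⊢
    linear_combination -h
  have hn1 : 0 ≤ (Nᴴ * N).trace := (posSemidef_conjTranspose_mul_self N).trace_nonneg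
  have hn2 : 0 ≤ ((S * W)ᴴ * (S * W)).trace :=
    (posSemidef_conjTranspose_mul_self (S * W)).trace_nonneg
  obtain ⟨z1, z2⟩ := (add_eq_zero_iff_of_nonneg hn1 hn2).mp hsum
  rw [trace_conjTranspose_mul_self_eq_zero_iff] at z1 z2
  have hR : Rᴴ = W * Wᴴ * Rᴴ := by
    have := congrArg conjTranspose (sub_eq_zero.mp z1)
    rwa [conjTranspose_mul, conjTranspose_mul, conjTranspose_conjTranspose,
      ← Matrix.mul_assoc] at this
  have hBW : B * W = c • W + Rᴴ * R * W := by
    conv_lhs => rw [hBd]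
    rw [Matrix.add_mul, Matrix.sub_mul, Matrix.mul_assoc Sᴴ, z2]
    simp
  have h2 : W * Wᴴ * (Rᴴ * R * W) = Rᴴ * R * W := by
    rw [← Matrix.mul_assoc, ← Matrix.mul_assoc, ← hR]
  rw [Matrix.mul_assoc Wᴴ, ← Matrix.mul_assoc, hBW, Matrix.mul_add, h2, Matrix.mul_smul,
    Matrix.mul_assoc W Wᴴ W, hW, Matrix.mul_one]

/-! ### An eigenbasis of `A` adapted to `B` -/

theorem exists_pos_le_abs_sub {n : ℕ} (f : Fin n → ℝ) :
    ∃ δ > 0, ∀ a b, f a ≠ f b → δ ≤ |f a - f b| := by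
  have : ∀ᶠ δ : ℝ in 𝓝[>] 0, ∀ a b, f a ≠ f b → δ ≤ |f a - f b| := by
    refine Filter.eventually_all.mpr fun a => Filter.eventually_all.mpr fun b => ?_
    by_cases h : f a = f b
    · exact Filter.Eventually.of_forall fun _ h' => absurd h h'
    · filter_upwards [Ioo_mem_nhdsGT (abs_pos.mpr (sub_ne_zero.mpr h))] with δ hδ _
      exact hδ.2.le
  obtain ⟨δ, h1, h2⟩ := (this.and self_mem_nhdsWithin).exists
  exact ⟨δ, h2, h1⟩

/-- An orthonormal eigenbasis of `A`, in decreasing order of the eigenvalues, that diagonalizes the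
compression of `B` to each eigenspace of `A`, with decreasing diagonal. -/
theorem exists_adapted_eigenbasis {n : ℕ} {A B : Matrix (Fin n) (Fin n) ℂ} (hA : A.IsHermitian)
    (hB : B.IsHermitian) : ∃ (X : Matrix (Fin n) (Fin n) ℂ) (ν : Fin n → ℝ),
      Xᴴ * X = 1 ∧ X * Xᴴ = 1 ∧ A * X = X * (diagonal fun j => (eig hA j : ℂ)) ∧
      (∀ j l, eig hA j = eig hA l →
        (Xᴴ * B * X) j l = (diagonal fun j => (ν j : ℂ)) j l) ∧
      ∀ j l, j ≤ l → eig hA j = eig hA l → ν l ≤ ν j := by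
  obtain ⟨Q, hQ, hQ', hAQ⟩ := exists_unitary_mul_eq_mul_diagonal_eig hA
  set lam := eig hA
  set B' := Qᴴ * B * Q
  have hB' : B'.IsHermitian := isHermitian_conjTranspose_mul_mul Q hB
  set D : Matrix (Fin n) (Fin n) ℂ := diagonal fun j => (lam j : ℂ)
  -- `C` keeps only the blocks of `B'` inside eigenspaces of `A`. For small `s` the eigenvalue
  -- clusters of `D + s • C` stay apart, so a single ordered diagonalization treats all blocks at
  -- once and sorts each of them.
  let C : Matrix (Fin n) (Fin n) ℂ := fun a b => if lam a = lam b then B' a b else 0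
  have hC : C.IsHermitian := by
    refine IsHermitian.ext fun a b => ?_
    simp only [C]
    by_cases h : lam a = lam b
    · rw [if_pos h, if_pos h.symm]; exact hB'.apply a b
    · rw [if_neg h, if_neg (Ne.symm h)]; simp
  have hD : D.IsHermitian := isHermitian_diagonal_ofReal lam
  set K : ℝ := ∑ a, ∑ b, ‖C a b‖ with hKdef
  have hK : 0 ≤ K := Finset.sum_nonneg fun a _ => Finset.sum_nonneg fun b _ => norm_nonneg _
  obtain ⟨δ, hδ, hgap⟩ := exists_pos_le_abs_sub lam
  obtain ⟨s, hs, hsK⟩ : ∃ s > 0, 2 * (s * K) < δ := by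
    refine ⟨δ / (2 * (K + 1)), by positivity, ?_⟩
    have : 2 * (δ / (2 * (K + 1)) * K) = δ * (K / (K + 1)) := by field_simp
    rw [this]
    have : K / (K + 1) < 1 := by rw [div_lt_one (by linarith)]; linarith
    nlinarith
  have hH : (D + s • C).IsHermitian := pencil_isHermitian hD hC s
  obtain ⟨Z, hZ, hZ', hHZ⟩ := exists_unitary_mul_eq_mul_diagonal_eig hH
  set η := eig hH
  have hη : ∀ j, |η j - lam j| ≤ s * K := fun j => by
    have h1 := abs_eig_sub_eig_le hH hD j
    have h2 : eig hD j = lam j := eig_diagonal (eig_antitone hA) j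
    rw [h2] at h1
    refine h1.trans_eq ?_
    rw [hKdef, Finset.mul_sum]
    refine Finset.sum_congr rfl fun a _ => ?_
    rw [Finset.mul_sum]
    refine Finset.sum_congr rfl fun b _ => ?_
    simp [abs_of_pos hs]
  have hentry : ∀ l j, (s : ℂ) * ∑ b, C l b * Z b j = ((η j - lam l : ℝ) : ℂ) * Z l j := by
    intro l j
    have := congrFun (congrFun hHZ l) j
    rw [mul_diagonal, Matrix.add_mul, Matrix.add_apply, diagonal_mul, Matrix.smul_mul,
      Matrix.smul_apply, mul_apply, Complex.real_smul] at this
    push_cast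
    linear_combination this
  -- Take the largest entry of column `j` within the cluster of `l`. Its row of the eigenvector
  -- equation puts `η j` within `s * K` of `lam l`; it is also that close to `lam j`, and the gap
  -- exceeds `2 * (s * K)`.
  have hsupp : ∀ l j, Z l j ≠ 0 → lam l = lam j := by
    intro l j hlj
    obtain ⟨m, hm, hmax⟩ := Finset.exists_max_image
      (Finset.univ.filter fun a => lam a = lam l) (fun a => ‖Z a j‖) ⟨l, by simp⟩
    have hm' : lam m = lam l := (Finset.mem_filter.mp hm).2
    have hmpos : 0 < ‖Z m j‖ := (norm_pos_iff.mpr hlj).trans_le (hmax l (by simp))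
    have hb : ‖∑ b, C m b * Z b j‖ ≤ K * ‖Z m j‖ := by
      calc ‖∑ b, C m b * Z b j‖ ≤ ∑ b, ‖C m b‖ * ‖Z m j‖ := by
            refine (norm_sum_le _ _).trans (Finset.sum_le_sum fun b _ => ?_)
            rw [norm_mul]
            by_cases hmb : lam m = lam b
            · exact mul_le_mul_of_nonneg_left (hmax b (by simp [← hmb, hm'])) (norm_nonneg _)
            · simp [C, hmb]
        _ = (∑ b, ‖C m b‖) * ‖Z m j‖ := by rw [Finset.sum_mul]
        _ ≤ K * ‖Z m j‖ := by
            refine mul_le_mul_of_nonneg_right ?_ (norm_nonneg _)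
            exact Finset.single_le_sum (f := fun a => ∑ b, ‖C a b‖)
              (fun a _ => Finset.sum_nonneg fun b _ => norm_nonneg _) (Finset.mem_univ m)
    have h1 := congrArg norm (hentry m j)
    rw [norm_mul, norm_mul, Complex.norm_real, Complex.norm_real, Real.norm_of_nonneg hs.le,
      Real.norm_eq_abs] at h1
    have h2 : |η j - lam m| ≤ s * K := by
      refine le_of_mul_le_mul_right ?_ hmpos
      rw [← h1, mul_assoc]
      exact mul_le_mul_of_nonneg_left hb hs.le
    by_contra hne
    have h3 := hgap l j hne
    have h4 := hη j
    rw [hm'] at h2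
    rw [abs_le] at h2 h4
    have : |lam l - lam j| ≤ 2 * (s * K) := abs_le.mpr ⟨by linarith, by linarith⟩
    linarith
  have hDZ : D * Z = Z * D := by
    ext l j
    rw [diagonal_mul, mul_diagonal, mul_comm]
    by_cases h : Z l j = 0
    · simp [h]
    · rw [hsupp l j h]
  set ν : Fin n → ℝ := fun j => (η j - lam j) / s with hν
  have hCZ : C * Z = Z * diagonal fun j => (ν j : ℂ) := by
    ext l j
    have hs' : (s : ℂ) ≠ 0 := by exact_mod_cast hs.ne'
    rw [mul_diagonal, mul_apply]
    apply mul_left_cancel₀ hs'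
    rw [hentry]
    by_cases h : Z l j = 0
    · simp [h]
    · rw [hsupp l j h, hν]
      push_cast
      field_simp
  refine ⟨Q * Z, ν, ?_, ?_, ?_, ?_, ?_⟩
  · rw [conjTranspose_mul, Matrix.mul_assoc, ← Matrix.mul_assoc Qᴴ, hQ, Matrix.one_mul, hZ]
  · rw [conjTranspose_mul, Matrix.mul_assoc, ← Matrix.mul_assoc Z, hZ', Matrix.one_mul, hQ']
  · rw [← Matrix.mul_assoc, hAQ, Matrix.mul_assoc, hDZ, Matrix.mul_assoc]
  · intro j l hjl
    have h1 : (Q * Z)ᴴ * B * (Q * Z) = Zᴴ * B' * Z := by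
      simp only [B', conjTranspose_mul, Matrix.mul_assoc]
    have h2 : (Zᴴ * C * Z) j l = (diagonal fun j => (ν j : ℂ)) j l := by
      rw [Matrix.mul_assoc, hCZ, ← Matrix.mul_assoc, hZ, Matrix.one_mul]
    rw [h1, ← h2, mul_apply, mul_apply]
    refine Finset.sum_congr rfl fun b _ => ?_
    by_cases hb : Z b l = 0
    · simp [hb]
    congr 1
    rw [mul_apply, mul_apply]
    refine Finset.sum_congr rfl fun a _ => ?_
    by_cases ha : Z a j = 0
    · simp [ha]
    congr 1
    simp only [C]
    rw [if_pos]
    rw [hsupp a j ha, hsupp b l hb, hjl]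
  · intro j l hjl heq
    have : η l ≤ η j := eig_antitone hH hjl
    simp only [hν]
    rw [heq]
    exact div_le_div_of_nonneg_right (by linarith) hs.le

/-! ### First-order expansion: existence and uniqueness of the coefficients -/

/-- First-order expansion of a conjugation by a one-parameter group in a Banach algebra. -/
theorem isLittleO_exp_conj {𝔸 : Type*} [NormedRing 𝔸] [NormedAlgebra ℝ 𝔸] [CompleteSpace 𝔸]
    (D E K : 𝔸) : (fun t : ℝ => NormedSpace.exp (t • (-K)) * (D + t • E) * NormedSpace.exp (t • K) -
      (D + t • (D * K - K * D + E))) =o[𝓝 0] fun t : ℝ => t := by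
  have h1 : HasDerivAt (fun t : ℝ => NormedSpace.exp (t • K)) K 0 := by
    simpa using hasDerivAt_exp_smul_const (𝕂 := ℝ) K (0 : ℝ)
  have h2 : HasDerivAt (fun t : ℝ => NormedSpace.exp (t • (-K))) (-K) 0 := by
    simpa [-smul_neg] using hasDerivAt_exp_smul_const (𝕂 := ℝ) (-K) (0 : ℝ)
  have h3 : HasDerivAt (fun t : ℝ => D + t • E) E 0 := by
    simpa using! ((hasDerivAt_id (0 : ℝ)).smul_const E).const_add D
  have h5 := hasDerivAt_iff_isLittleO.mp ((h2.mul h3).mul h1)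
  simp only [Pi.mul_apply, sub_zero, zero_smul, NormedSpace.exp_zero, add_zero, mul_one,
    one_mul] at h5
  refine h5.congr_left fun t => ?_
  rw [sub_sub, neg_mul, neg_add_eq_sub, sub_add_eq_add_sub, add_comm E, ← sub_add_eq_add_sub]

section MatrixExp

open scoped Matrix.Norms.Operator

/-- Differentiation at `0` of a hermitian pencil conjugated by a one-parameter unitary group. -/
theorem exists_unitary_conj_pencil_isLittleO {n : ℕ} (D E K : Matrix (Fin n) (Fin n) ℂ)
    (hK : Kᴴ = -K) : ∃ U : ℝ → Matrix (Fin n) (Fin n) ℂ, (∀ t, U t * (U t)ᴴ = 1) ∧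
      ∀ a b, (fun t : ℝ => ((U t)ᴴ * (D + t • E) * U t - (D + t • (D * K - K * D + E))) a b)
        =o[𝓝 0] fun t : ℝ => t := by
  have hU : ∀ t : ℝ, (NormedSpace.exp (t • K))ᴴ = NormedSpace.exp (t • (-K)) := fun t => by
    rw [← Matrix.exp_conjTranspose, conjTranspose_smul, hK, star_trivial]
  refine ⟨fun t => NormedSpace.exp (t • K), fun t => ?_, fun a b => ?_⟩
  · rw [hU, smul_neg, Matrix.exp_neg]
    exact mul_nonsing_inv _ ((isUnit_iff_isUnit_det _).mp (Matrix.isUnit_exp _))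
  · simp only [hU]
    exact ((Matrix.entryLinearMap ℝ ℂ a b).toContinuousLinearMap.isBigO_comp _ _).trans_isLittleO
      (isLittleO_exp_conj D E K)

end MatrixExp

theorem eq_zero_of_const_mul_isLittleO {c : ℝ}
    (h : (fun t : ℝ => c * t) =o[𝓝[>] 0] fun t : ℝ => t) : c = 0 := by
  by_contra hc
  rw [isLittleO_const_mul_left_iff hc] at h
  refine isLittleO_irrefl ?_ h
  have : ∀ᶠ t : ℝ in 𝓝[>] 0, t ≠ 0 := by
    filter_upwards [self_mem_nhdsWithin] with t ht using ne_of_gt ht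
  exact this.frequently

theorem isLittleO_sum_norm {n : ℕ} {F : ℝ → Matrix (Fin n) (Fin n) ℂ}
    {l : Filter ℝ} (h : ∀ a b, (fun t => F t a b) =o[l] fun t : ℝ => t) :
    (fun t => ∑ a, ∑ b, ‖F t a b‖) =o[l] fun t : ℝ => t :=
  IsLittleO.fun_sum fun a _ => IsLittleO.fun_sum fun b _ => (h a b).norm_left

/-- First-order expansion of the eigenvalues of a hermitian pencil in terms of an adapted
eigenbasis. -/
theorem isPerturbationCoefficients_of_adapted {n : ℕ} {A B X : Matrix (Fin n) (Fin n) ℂ}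
    (hA : A.IsHermitian) (hB : B.IsHermitian) {ν : Fin n → ℝ} (hX : Xᴴ * X = 1)
    (hX' : X * Xᴴ = 1) (hAX : A * X = X * diagonal fun j => (eig hA j : ℂ))
    (hBX : ∀ j l, eig hA j = eig hA l →
        (Xᴴ * B * X) j l = (diagonal fun j => (ν j : ℂ)) j l)
    (hν : ∀ j l, j ≤ l → eig hA j = eig hA l → ν l ≤ ν j) :
    IsPerturbationCoefficients hA hB ν := by
  refine ⟨⟨1, one_pos, ?_⟩, hν⟩
  set D : Matrix (Fin n) (Fin n) ℂ := diagonal fun j => (eig hA j : ℂ)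
  set E := Xᴴ * B * X
  have hE : E.IsHermitian := isHermitian_conjTranspose_mul_mul X hB
  -- `K` solves `D * K - K * D + E = diagonal ν`: it cancels `E` between different eigenvalues.
  -- Within one eigenvalue division by zero makes `K` vanish, and `E` is already diagonal there.
  let K : Matrix (Fin n) (Fin n) ℂ := fun a b => E a b / ((eig hA b - eig hA a : ℝ) : ℂ)
  have hK : Kᴴ = -K := by
    ext a b
    rw [conjTranspose_apply, Matrix.neg_apply]
    simp only [K]
    rw [star_div₀, hE.apply, ← neg_sub (eig hA a), Complex.ofReal_neg, div_neg]
    simp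
  have hcomm : D * K - K * D + E = diagonal fun j => (ν j : ℂ) := by
    ext a b
    rw [Matrix.add_apply, Matrix.sub_apply, diagonal_mul, mul_diagonal]
    simp only [K]
    by_cases h : eig hA a = eig hA b
    · rw [← hBX a b h, h]; ring
    · have h' : ((eig hA b - eig hA a : ℝ) : ℂ) ≠ 0 := by
        exact_mod_cast sub_ne_zero.mpr (Ne.symm h)
      have hab : a ≠ b := fun e => h (by rw [e])
      rw [diagonal_apply_ne _ hab]
      field_simp
      push_cast
      ring
  obtain ⟨U, hU, hO⟩ := exists_unitary_conj_pencil_isLittleO D E K hK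
  rw [hcomm] at hO
  set β : ℝ → Fin n → ℝ := fun t j => eig hA j + t * ν j with hβ
  have hdiag : ∀ t : ℝ, D + t • (diagonal fun j => (ν j : ℂ)) =
      diagonal fun j => (β t j : ℂ) := fun t => by
    ext a b
    by_cases h : a = b
    · subst h; simp [D, hβ]
    · simp [D, h]
  -- The numbers `β t j` need not be sorted in `j`; `σ t` gives their positions. No regularity of
  -- `σ` in `t` is needed.
  choose σ hσ using fun t => exists_perm_eig_diagonal (β t)
  refine ⟨fun j t => eig (pencil_isHermitian hA hB t) (σ t j), fun t _ => ⟨σ t, fun j => rfl⟩,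
    fun j => ?_⟩
  have hM : ∀ t, ((U t)ᴴ * (D + t • E) * U t).IsHermitian := fun t =>
    isHermitian_conjTranspose_mul_mul _
      (pencil_isHermitian (isHermitian_diagonal_ofReal _) hE t)
  refine IsBigO.trans_isLittleO (IsBigO.of_bound 1 (Filter.Eventually.of_forall fun t => ?_))
    (isLittleO_sum_norm hO)
  have hconj : (U t)ᴴ * (D + t • E) * U t = (X * U t)ᴴ * (A + t • B) * (X * U t) := by
    have hD : D = Xᴴ * A * X := by
      rw [Matrix.mul_assoc, hAX, ← Matrix.mul_assoc, hX, Matrix.one_mul]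
    rw [hD]
    simp only [E, conjTranspose_mul, Matrix.mul_add, Matrix.add_mul, Matrix.mul_smul,
      Matrix.smul_mul, Matrix.mul_assoc]
  have hXU : X * U t * (X * U t)ᴴ = 1 := by
    rw [conjTranspose_mul, Matrix.mul_assoc, ← Matrix.mul_assoc (U t), hU, Matrix.one_mul, hX']
  have h1 := abs_eig_sub_eig_le (hM t) (isHermitian_diagonal_ofReal (β t)) (σ t j)
  rw [eig_conj_unitary (pencil_isHermitian hA hB t) (hM t) hXU hconj, hσ t j] at h1
  rw [one_mul, Real.norm_eq_abs, Real.norm_eq_abs]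
  refine (h1.trans_eq ?_).trans (le_abs_self _)
  simp only [hdiag, Matrix.sub_apply]

/-- For small `t > 0` the affine approximations are already in decreasing order, and sorting is
Lipschitz (compare diagonal matrices), so the expansion passes from the arrangement `α` to the
ordered eigenvalues. For `t < 0` the order inside a cluster reverses, hence the one-sided filter. -/
theorem IsPerturbationCoefficients.isLittleO_eig {n : ℕ} {A B : Matrix (Fin n) (Fin n) ℂ}
    {hA : A.IsHermitian} {hB : B.IsHermitian} {ν : Fin n → ℝ}
    (h : IsPerturbationCoefficients hA hB ν) (j : Fin n) :
    (fun t : ℝ => eig (pencil_isHermitian hA hB t) j - (eig hA j + t * ν j))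
      =o[𝓝[>] 0] fun t : ℝ => t := by
  obtain ⟨⟨r, hr, α, hα, hO⟩, hν⟩ := h
  have hsum : (fun t : ℝ => ∑ l, ‖α l t - (eig hA l + t * ν l)‖) =o[𝓝[>] 0] fun t : ℝ => t :=
    IsLittleO.fun_sum fun l _ => ((hO l).mono nhdsWithin_le_nhds).norm_left
  refine IsBigO.trans_isLittleO (IsBigO.of_bound 1 ?_) hsum
  have hanti : ∀ᶠ t : ℝ in 𝓝[>] 0, ∀ a b : Fin n, a ≤ b →
      eig hA b + t * ν b ≤ eig hA a + t * ν a := by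
    refine Filter.eventually_all.mpr fun a => Filter.eventually_all.mpr fun b => ?_
    by_cases hab : a ≤ b
    swap
    · exact Filter.Eventually.of_forall fun _ h' => absurd h' hab
    rcases (eig_antitone hA hab).eq_or_lt with heq | hlt
    · filter_upwards [self_mem_nhdsWithin] with t ht _
      have := hν a b hab heq.symm
      rw [heq]
      have := mul_le_mul_of_nonneg_left this (le_of_lt ht)
      linarith
    · have hc : ∀ c : Fin n, Filter.Tendsto (fun t : ℝ => eig hA c + t * ν c) (𝓝[>] 0)
          (𝓝 (eig hA c)) := fun c => by
        have : Continuous fun t : ℝ => eig hA c + t * ν c := by fun_prop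
        simpa using (this.tendsto 0).mono_left nhdsWithin_le_nhds
      filter_upwards [(hc b).eventually_lt (hc a) hlt] with t ht _ using ht.le
  have hsmall : ∀ᶠ t : ℝ in 𝓝[>] 0, |t| < r := by
    filter_upwards [Ioo_mem_nhdsGT hr] with t ht
    rw [abs_of_pos ht.1]; exact ht.2
  filter_upwards [hanti, hsmall] with t ha ht
  obtain ⟨σ, hσ⟩ := hα t ht
  have h1 : eig (isHermitian_diagonal_ofReal fun l => α l t) j =
      eig (pencil_isHermitian hA hB t) j := by
    refine eig_eq_of_mul_eq_mul_diagonal (V := (Equiv.toPEquiv σ).toMatrix)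
      (L := (Equiv.toPEquiv σ.symm).toMatrix) _ ?_ (eig_antitone _) ?_ j
    · rw [← PEquiv.toMatrix_trans, ← Equiv.toPEquiv_trans]
      simp
    · ext x y
      rw [diagonal_mul, mul_diagonal, PEquiv.toMatrix_apply]
      by_cases hxy : σ x = y
      · subst hxy; simp [hσ]
      · simp [hxy]
  have h2 : eig (isHermitian_diagonal_ofReal fun l => eig hA l + t * ν l) j =
      eig hA j + t * ν j := eig_diagonal (fun x y hxy => ha x y hxy) j
  have h3 := abs_eig_sub_eig_le (isHermitian_diagonal_ofReal fun l => α l t)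
    (isHermitian_diagonal_ofReal fun l => eig hA l + t * ν l) j
  rw [h1, h2] at h3
  rw [one_mul, Real.norm_eq_abs, Real.norm_eq_abs]
  refine (h3.trans_eq ?_).trans (le_abs_self _)
  refine Finset.sum_congr rfl fun x _ => ?_
  rw [Finset.sum_eq_single x (fun y _ hy => by simp [hy.symm]) (by simp)]
  rw [diagonal_apply_eq, diagonal_apply_eq, ← Complex.ofReal_sub, Complex.norm_real]

theorem IsPerturbationCoefficients.eq {n : ℕ} {A B : Matrix (Fin n) (Fin n) ℂ}
    {hA : A.IsHermitian} {hB : B.IsHermitian} {ν ν' : Fin n → ℝ}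
    (h : IsPerturbationCoefficients hA hB ν) (h' : IsPerturbationCoefficients hA hB ν') :
    ν = ν' := by
  ext j
  have h1 := ((h'.isLittleO_eig j).sub (h.isLittleO_eig j)).congr_left
    (f₂ := fun t : ℝ => (ν j - ν' j) * t) fun t => by ring
  exact sub_eq_zero.mp (eq_zero_of_const_mul_isLittleO h1)

/-! ### Invariant subspaces and compressions -/

theorem isInvariantSpannedByEigenvectors_range {n k : ℕ} {M : Matrix (Fin n) (Fin n) ℂ}
    {V : Matrix (Fin n) (Fin k) ℂ} (hV : Vᴴ * V = 1) {μ : Fin k → ℝ}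
    (h : M * V = V * diagonal fun j => (μ j : ℂ)) :
    IsInvariantSpannedByEigenvectors M μ (LinearMap.range V.mulVecLin) := by
  refine ⟨?_, fun j => V.col j, fun j => ?_, (range_mulVecLin V).symm⟩
  · rintro _ ⟨v, rfl⟩
    refine ⟨(diagonal fun j => (μ j : ℂ)) *ᵥ v, ?_⟩
    rw [mulVecLin_apply, mulVecLin_apply, mulVec_mulVec, mulVec_mulVec, h]
  · rw [Module.End.hasEigenvector_iff, Module.End.mem_eigenspace_iff]
    constructor
    · ext a
      have := congrFun (congrFun h a) j
      rw [mul_diagonal] at this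
      rw [toLin'_apply, Pi.smul_apply, smul_eq_mul, mul_comm]
      exact this
    · intro h0
      have := congrFun (congrFun hV j) j
      rw [mul_apply, one_apply_eq] at this
      have h1 : ∀ a, V a j = 0 := fun a => congrFun h0 a
      simp [h1] at this

theorem mulVec_injective_of_isometry {n k : ℕ} {V : Matrix (Fin n) (Fin k) ℂ} (hV : Vᴴ * V = 1) :
    Function.Injective V.mulVecLin := fun v w h => by
  have := congrArg (Vᴴ *ᵥ ·) h
  simpa [mulVec_mulVec, hV] using this

theorem exists_isometry_range_eq {n k : ℕ} {U : Submodule ℂ (Fin n → ℂ)}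
    (hU : Module.finrank ℂ U = k) :
    ∃ W : Matrix (Fin n) (Fin k) ℂ, Wᴴ * W = 1 ∧ LinearMap.range W.mulVecLin = U := by
  set e : EuclideanSpace ℂ (Fin n) ≃ₗ[ℂ] (Fin n → ℂ) := WithLp.linearEquiv 2 ℂ (Fin n → ℂ)
  set U' : Submodule ℂ (EuclideanSpace ℂ (Fin n)) := U.map (e.symm : _ →ₗ[ℂ] _)
  have hU' : Module.finrank ℂ U' = k := by
    rw [← hU]; exact LinearEquiv.finrank_map_eq e.symm U
  let b := (stdOrthonormalBasis ℂ U').reindex (finCongr hU')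
  refine ⟨Matrix.of fun a j => (b j : EuclideanSpace ℂ (Fin n)) a, ?_, ?_⟩
  · ext j l
    have := orthonormal_iff_ite.mp b.orthonormal j l
    rw [Submodule.coe_inner, EuclideanSpace.inner_eq_star_dotProduct] at this
    rw [mul_apply, one_apply, ← this, dotProduct]
    exact Finset.sum_congr rfl fun a _ => mul_comm _ _
  · rw [range_mulVecLin]
    have h1 : Set.range (Matrix.of fun a j => (b j : EuclideanSpace ℂ (Fin n)) a).col =
        (e : EuclideanSpace ℂ (Fin n) →ₗ[ℂ] (Fin n → ℂ)) '' (U'.subtype '' Set.range b) := by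
      rw [← Set.range_comp, ← Set.range_comp]
      rfl
    have h2 : Submodule.span ℂ (Set.range b) = ⊤ := by
      rw [← b.coe_toBasis]; exact b.toBasis.span_eq
    rw [h1, Submodule.span_image, Submodule.span_image, h2, Submodule.map_subtype_top]
    simp only [U']
    rw [← Submodule.map_comp]
    simp

/-- The given eigenvectors need not be orthogonal. Their coordinates in the orthonormal columns of
`W` form a matrix `Y`, invertible because the eigenvectors span the range, and `Y` diagonalizes the
compression. -/
theorem IsInvariantSpannedByEigenvectors.compression {n k : ℕ} {M : Matrix (Fin n) (Fin n) ℂ}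
    (hM : M.IsHermitian) {μ : Fin k → ℝ} (hμ : Antitone μ) {W : Matrix (Fin n) (Fin k) ℂ}
    (hW : Wᴴ * W = 1) (h : IsInvariantSpannedByEigenvectors M μ (LinearMap.range W.mulVecLin)) :
    M * W = W * (Wᴴ * M * W) ∧
      ∀ j, eig (isHermitian_conjTranspose_mul_mul W hM) j = μ j := by
  obtain ⟨hinv, x, hx, hspan⟩ := h
  refine ⟨?_, ?_⟩
  · apply Matrix.mulVec_injective
    ext1 v
    obtain ⟨u, hu⟩ := hinv (W *ᵥ v) ⟨v, rfl⟩
    rw [mulVecLin_apply] at hu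
    rw [← mulVec_mulVec, ← mulVec_mulVec, ← mulVec_mulVec, ← mulVec_mulVec, ← hu,
      mulVec_mulVec u Wᴴ, hW, one_mulVec]
  · have hmem : ∀ j, ∃ y, W *ᵥ y = x j := fun j => by
      have : x j ∈ LinearMap.range W.mulVecLin := hspan ▸ Submodule.subset_span ⟨j, rfl⟩
      exact this
    choose y hy using hmem
    set X : Matrix (Fin n) (Fin k) ℂ := Matrix.of fun a j => x j a
    set Y : Matrix (Fin k) (Fin k) ℂ := Matrix.of fun a j => y j a
    have hX : W * Y = X := by
      ext a j
      exact congrFun (hy j) a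
    have hY : Y = Wᴴ * X := by rw [← hX, ← Matrix.mul_assoc, hW, Matrix.one_mul]
    have hMX : M * X = X * diagonal fun j => (μ j : ℂ) := by
      ext a j
      have := congrFun (Module.End.mem_eigenspace_iff.mp (hx j).1) a
      rw [toLin'_apply, Pi.smul_apply, smul_eq_mul, mul_comm] at this
      rw [mul_diagonal]
      exact this
    have hsurj : Function.Surjective Y.mulVec := fun v => by
      have : W *ᵥ v ∈ LinearMap.range X.mulVecLin := by
        rw [range_mulVecLin]
        change W *ᵥ v ∈ Submodule.span ℂ (Set.range x)
        rw [hspan]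
        exact ⟨v, rfl⟩
      obtain ⟨c, hc⟩ := this
      refine ⟨c, ?_⟩
      rw [mulVecLin_apply] at hc
      rw [hY, ← mulVec_mulVec, hc, mulVec_mulVec, hW, one_mulVec]
    have hdet : ((1 : Matrix (Fin k) (Fin k) ℂ) * Y).det ≠ 0 := by
      rw [Matrix.one_mul]
      exact ((isUnit_iff_isUnit_det _).mp (mulVec_surjective_iff_isUnit.mp hsurj)).ne_zero
    refine eig_eq_of_mul_eq_mul_diagonal _ hdet hμ ?_
    rw [Matrix.mul_assoc, hX, Matrix.mul_assoc, hMX, ← Matrix.mul_assoc, ← hY]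

/-- The eigenvalues of a hermitian matrix on an invariant subspace are among its eigenvalues. -/
theorem exists_strictMono_eig_of_invariant {n k : ℕ} {M : Matrix (Fin n) (Fin n) ℂ}
    (hM : M.IsHermitian) {N : Matrix (Fin k) (Fin k) ℂ} (hN : N.IsHermitian)
    {W : Matrix (Fin n) (Fin k) ℂ} (hW : Wᴴ * W = 1) (h : M * W = W * N) :
    ∃ p : Fin k → Fin n, StrictMono p ∧ ∀ j, eig hM (p j) = eig hN j := by
  obtain ⟨Z, hZ, hZ', hNZ⟩ := exists_unitary_mul_eq_mul_diagonal_eig hN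
  refine exists_strictMono_eig_comp hM (V := W * Z) (L := Zᴴ * Wᴴ) ?_ (eig_antitone hN) ?_
  · rw [Matrix.mul_assoc, ← Matrix.mul_assoc Wᴴ, hW, Matrix.one_mul, hZ]; simp
  · rw [← Matrix.mul_assoc, h, Matrix.mul_assoc, hNZ, Matrix.mul_assoc]

theorem Fin.castLE_le_of_strictMono {n k : ℕ} (hk : k ≤ n) {q : Fin k → Fin n}
    (hq : StrictMono q) (j : Fin k) : Fin.castLE hk j ≤ q j := by
  obtain ⟨j, hj⟩ := j
  induction j with
  | zero => exact Nat.zero_le _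
  | succ m ih =>
    exact (Nat.succ_le_succ (ih (by omega))).trans
      (hq (show (⟨m, by omega⟩ : Fin k) < ⟨m + 1, hj⟩ from Nat.lt_succ_self m))

/-! ### The three implications -/

theorem exists_common_invariant_of_sum_eq {n k : ℕ} {A B X : Matrix (Fin n) (Fin n) ℂ}
    (hA : A.IsHermitian) (hB : B.IsHermitian) (hk : k ≤ n) {ν : Fin n → ℝ} (hX : Xᴴ * X = 1)
    (hAX : A * X = X * diagonal fun j => (eig hA j : ℂ))
    (hν : ∀ j, (Xᴴ * B * X) j j = ν j) {p : Fin k → Fin n} (hp : StrictMono p)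
    (hsum : ∑ j, ν (p j) = ∑ j : Fin k, eig hB (Fin.castLE hk j)) :
    ∃ U : Submodule ℂ (Fin n → ℂ), Module.finrank ℂ U = k ∧
      IsInvariantSpannedByEigenvectors A (fun j : Fin k => eig hA (p j)) U ∧
      IsInvariantSpannedByEigenvectors B (fun j : Fin k => eig hB (Fin.castLE hk j)) U := by
  set W : Matrix (Fin n) (Fin k) ℂ := X.submatrix id p
  have hW : Wᴴ * W = 1 := by
    rw [conjTranspose_submatrix]
    exact (submatrix_mul _ _ p id p Function.bijective_id).symm.trans
      (by rw [hX, submatrix_one _ hp.injective])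
  have hAW : A * W = W * diagonal fun j => (eig hA (p j) : ℂ) := by
    ext a j
    have := congrFun (congrFun hAX a) (p j)
    rw [mul_diagonal] at this ⊢
    exact this
  have hWB : (Wᴴ * B * W).IsHermitian := isHermitian_conjTranspose_mul_mul W hB
  have htr : (Wᴴ * B * W).trace = ((∑ j : Fin k, eig hB (Fin.castLE hk j) : ℝ) : ℂ) := by
    rw [← hsum, Complex.ofReal_sum]
    exact Finset.sum_congr rfl fun j _ => hν (p j)
  have hBW := mul_eq_of_trace_compression_eq hB hk hW htr
  obtain ⟨q, hq, hqe⟩ := exists_strictMono_eig_of_invariant hB hWB hW hBW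
  -- The compression's eigenvalues occupy increasing positions among those of `B`, hence are
  -- termwise at most the top `k`; equal traces force equality in each term.
  have hle : ∀ j : Fin k, eig hWB j ≤ eig hB (Fin.castLE hk j) := fun j => by
    rw [← hqe]
    exact eig_antitone hB (Fin.castLE_le_of_strictMono hk hq j)
  have hsum' : ∑ j, eig hWB j = ∑ j : Fin k, eig hB (Fin.castLE hk j) := by
    have := (sum_eig_eq_trace hWB).trans htr
    exact_mod_cast this
  have heq : ∀ j : Fin k, eig hWB j = eig hB (Fin.castLE hk j) := fun j =>
    (Finset.sum_eq_sum_iff_of_le fun j _ => hle j).mp hsum' j (Finset.mem_univ j)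
  obtain ⟨Z, hZ, hZ', hNZ⟩ := exists_unitary_mul_eq_mul_diagonal_eig hWB
  have hrange : LinearMap.range (W * Z).mulVecLin = LinearMap.range W.mulVecLin := by
    rw [mulVecLin_mul]
    refine LinearMap.range_comp_of_range_eq_top _ (LinearMap.range_eq_top.mpr fun v => ⟨Zᴴ *ᵥ v, ?_⟩)
    rw [mulVecLin_apply, mulVec_mulVec, hZ', one_mulVec]
  refine ⟨LinearMap.range W.mulVecLin, ?_, isInvariantSpannedByEigenvectors_range hW hAW, ?_⟩
  · rw [LinearMap.finrank_range_of_inj (mulVec_injective_of_isometry hW)]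
    simp
  · rw [← hrange]
    refine isInvariantSpannedByEigenvectors_range ?_ ?_
    · rw [conjTranspose_mul, Matrix.mul_assoc, ← Matrix.mul_assoc Wᴴ, hW, Matrix.one_mul, hZ]
    · simp only [heq] at hNZ
      rw [← Matrix.mul_assoc, hBW, Matrix.mul_assoc W, hNZ, ← Matrix.mul_assoc]

theorem exists_pos_sum_eig_eq_of_common_invariant {n k : ℕ} {A B : Matrix (Fin n) (Fin n) ℂ}
    (hA : A.IsHermitian) (hB : B.IsHermitian) {μ θ : Fin k → ℝ} (hμ : Antitone μ)
    (hθ : Antitone θ) (hμA : ∀ j, ∃ i, eig hA i = μ j) {U : Submodule ℂ (Fin n → ℂ)}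
    (hU : Module.finrank ℂ U = k) (hUA : IsInvariantSpannedByEigenvectors A μ U)
    (hUB : IsInvariantSpannedByEigenvectors B θ U) :
    ∃ t : ℝ, 0 < t ∧ ∃ p : Fin k → Fin n, StrictMono p ∧
      ∑ j, eig (pencil_isHermitian hA hB t) (p j) = ∑ j, eig hA (p j) + t * ∑ j, θ j ∧
      ∀ j, eig hA (p j) = μ j := by
  obtain ⟨W, hW, rfl⟩ := exists_isometry_range_eq hU
  obtain ⟨hAW, heA⟩ := hUA.compression hA hμ hW
  obtain ⟨hBW, heB⟩ := hUB.compression hB hθ hW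
  have hA1 : (Wᴴ * A * W).IsHermitian := isHermitian_conjTranspose_mul_mul W hA
  have hB1 : (Wᴴ * B * W).IsHermitian := isHermitian_conjTranspose_mul_mul W hB
  obtain ⟨δ, hδ, hgap⟩ := exists_pos_le_abs_sub (eig hA)
  have hpert : ∀ {m : ℕ} {X Y : Matrix (Fin m) (Fin m) ℂ} (hX : X.IsHermitian)
      (hY : Y.IsHermitian) {t : ℝ}, 0 < t → ∀ j,
      |eig (pencil_isHermitian hX hY t) j - eig hX j| ≤ t * ∑ a, ∑ b, ‖Y a b‖ := by
    intro m X Y hX hY t ht j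
    refine (abs_eig_sub_eig_le (pencil_isHermitian hX hY t) hX j).trans_eq ?_
    rw [Finset.mul_sum]
    refine Finset.sum_congr rfl fun a _ => ?_
    rw [Finset.mul_sum]
    refine Finset.sum_congr rfl fun b _ => ?_
    simp [abs_of_pos ht]
  set K := ∑ a, ∑ b, ‖B a b‖
  set K₁ := ∑ a, ∑ b, ‖(Wᴴ * B * W) a b‖
  have hK : 0 ≤ K := Finset.sum_nonneg fun a _ => Finset.sum_nonneg fun b _ => norm_nonneg _
  have hK₁ : 0 ≤ K₁ := Finset.sum_nonneg fun a _ => Finset.sum_nonneg fun b _ => norm_nonneg _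
  -- The drift of the full pencil (`K`) and that of the restricted pencil (`K₁`) must together stay
  -- below the spectral gap of `A`.
  obtain ⟨t, ht, htK⟩ : ∃ t > 0, t * (K + K₁) < δ := by
    refine ⟨δ / (K + K₁ + 1), by positivity, ?_⟩
    rw [div_mul_eq_mul_div, div_lt_iff₀ (by positivity)]
    nlinarith
  obtain ⟨p, hp, hpe⟩ := exists_strictMono_eig_of_invariant (pencil_isHermitian hA hB t)
    (pencil_isHermitian hA1 hB1 t) hW (by
      rw [Matrix.add_mul, Matrix.mul_add, Matrix.smul_mul, Matrix.mul_smul, ← hAW, ← hBW])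
  have hval : ∀ j, eig hA (p j) = μ j := fun j => by
    obtain ⟨i, hi⟩ := hμA j
    rw [← hi]
    by_contra hne
    have h1 := hgap _ _ hne
    have h2 := abs_le.mp (hpert hA hB ht (p j))
    have h3 := abs_le.mp (hpert hA1 hB1 ht j)
    rw [heA j, ← hpe j, ← hi] at h3
    have : |eig hA (p j) - eig hA i| ≤ t * (K + K₁) := by
      rw [mul_add]
      exact abs_le.mpr ⟨by linarith, by linarith⟩
    linarith
  refine ⟨t, ht, p, hp, ?_, hval⟩
  simp only [hpe, hval]
  have : ((∑ j, eig (pencil_isHermitian hA1 hB1 t) j : ℝ) : ℂ) =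
      ((∑ j, μ j + t * ∑ j, θ j : ℝ) : ℂ) := by
    rw [sum_eig_eq_trace, trace_add, trace_smul, ← sum_eig_eq_trace hA1, ← sum_eig_eq_trace hB1]
    simp [heA, heB]
  exact_mod_cast this

/-- Lidskii's inequality from `0` to `s` and from `s` to `t` bounds the sum at `s` from above and
from below by the same affine function; comparison with the first-order expansion gives the slope.
-/
theorem sum_coefficients_eq_of_sum_eig_eq {n k : ℕ} {A B : Matrix (Fin n) (Fin n) ℂ}
    {hA : A.IsHermitian} {hB : B.IsHermitian} (hk : k ≤ n) {ν : Fin n → ℝ}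
    (hν : IsPerturbationCoefficients hA hB ν) {t : ℝ} (ht : 0 < t) {p : Fin k → Fin n}
    (hp : StrictMono p)
    (h : ∑ j, eig (pencil_isHermitian hA hB t) (p j) =
      ∑ j, eig hA (p j) + t * ∑ j : Fin k, eig hB (Fin.castLE hk j)) :
    ∑ j, ν (p j) = ∑ j : Fin k, eig hB (Fin.castLE hk j) := by
  set C := ∑ j : Fin k, eig hB (Fin.castLE hk j)
  have hlin : ∀ᶠ s : ℝ in 𝓝[>] 0, ∑ j, eig (pencil_isHermitian hA hB s) (p j) =
      ∑ j, eig hA (p j) + s * C := by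
    filter_upwards [Ioo_mem_nhdsGT ht] with s hs
    have h1 := sum_eig_add_smul_le hA (pencil_isHermitian hA hB s) hB hk hs.1.le rfl hp
    have h2 := sum_eig_add_smul_le (pencil_isHermitian hA hB s) (pencil_isHermitian hA hB t) hB hk
      (sub_nonneg.mpr hs.2.le) (by rw [add_assoc, ← add_smul, add_sub_cancel]) hp
    rw [h] at h2
    linarith
  have hO : (fun s : ℝ => ∑ j, (eig (pencil_isHermitian hA hB s) (p j) -
      (eig hA (p j) + s * ν (p j)))) =o[𝓝[>] 0] fun s : ℝ => s :=
    IsLittleO.fun_sum fun j _ => hν.isLittleO_eig (p j)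
  have hO' : (fun s : ℝ => (C - ∑ j, ν (p j)) * s) =o[𝓝[>] 0] fun s : ℝ => s := by
    refine hO.congr' ?_ Filter.EventuallyEq.rfl
    filter_upwards [hlin] with s hs
    rw [Finset.sum_sub_distrib, hs, Finset.sum_add_distrib, ← Finset.mul_sum]
    ring
  linarith [eq_zero_of_const_mul_isLittleO hO']

end

theorem proposition4p1 {n k : ℕ} {A B : Matrix (Fin n) (Fin n) ℂ}
    (hA : A.IsHermitian) (hB : B.IsHermitian) (hk : k ≤ n)
    (i : Fin k → Fin n) (hi : StrictMono i) :
    (∃! ν : Fin n → ℝ, IsPerturbationCoefficients hA hB ν) ∧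
    ∀ ν : Fin n → ℝ, IsPerturbationCoefficients hA hB ν →
      List.TFAE [
        ∃ U : Submodule ℂ (Fin n → ℂ), Module.finrank ℂ U = k ∧
          IsInvariantSpannedByEigenvectors A (fun j : Fin k => eig hA (i j)) U ∧
          IsInvariantSpannedByEigenvectors B (fun j : Fin k => eig hB (Fin.castLE hk j)) U,
        ∃ t₁ : ℝ, 0 < t₁ ∧ ∃ p : Fin k → Fin n, StrictMono p ∧
          ∑ j, eig (pencil_isHermitian hA hB t₁) (p j) =
            ∑ j, eig hA (p j) + t₁ * ∑ j : Fin k, eig hB (Fin.castLE hk j) ∧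
          ∀ j, eig hA (p j) = eig hA (i j),
        ∃ p : Fin k → Fin n, StrictMono p ∧
          ∑ j, ν (p j) = ∑ j : Fin k, eig hB (Fin.castLE hk j) ∧
          ∀ j, eig hA (p j) = eig hA (i j)] := by
  obtain ⟨X, ν₀, hX, hX', hAX, hBX, hmono⟩ := exists_adapted_eigenbasis hA hB
  have hν₀ := isPerturbationCoefficients_of_adapted hA hB hX hX' hAX hBX hmono
  refine ⟨⟨ν₀, hν₀, fun ν hν => hν.eq hν₀⟩, fun ν hν => ?_⟩
  -- By uniqueness `ν` is the family read off from the adapted eigenbasis, so its values are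
  -- diagonal entries of `Xᴴ * B * X`.
  obtain rfl := hν.eq hν₀
  tfae_have 1 → 2 := fun ⟨U, hU, hUA, hUB⟩ =>
    exists_pos_sum_eig_eq_of_common_invariant hA hB
      ((eig_antitone hA).comp_monotone hi.monotone)
      (fun _ _ h => eig_antitone hB h) (fun j => ⟨i j, rfl⟩) hU hUA hUB
  tfae_have 2 → 3 := fun ⟨t, ht, p, hp, hsum, hpi⟩ =>
    ⟨p, hp, sum_coefficients_eq_of_sum_eig_eq hk hν ht hp hsum, hpi⟩
  tfae_have 3 → 1 := fun ⟨p, hp, hsum, hpi⟩ => by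
    simpa only [hpi] using exists_common_invariant_of_sum_eq hA hB hk hX hAX
      (fun j => by rw [hBX j j rfl, Matrix.diagonal_apply_eq]) hp hsum
  tfae_finish
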